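/- Setting. Let $\Sigma = CS \uplus FS$ be a signature of constructor symbols $CS=\bigcup_n CS^n$ and function symbols $FS=\bigcup_n FS^n$ (disjoint, each symbol with an arity $n$), with a distinguished function symbol $? \in FS^2$ written infix, and let $\mathcal V$ be a countably infinite set of variables. Expressions are given by $e ::= X \mid h(e_1,\dots,e_n)$ with $X\in\mathcal V$ and $h\in CS^n\cup FS^n$; c-terms are the expressions without function symbols; an expression is ground if no variable occurs in it. A substitution $\sigma$ maps variables to expressions and has finite domain $\mathrm{dom}(\sigma)=\{X\mid X\sigma\neq X\}$. A program (left-linear constructor system) $P$ over $\Sigma$ is a set of rules $f(p_1,\dots,p_n)\to r$, where $f\in FS^n$, $r$ is an expression, and $(p_1,\dots,p_n)$ is a tuple of c-terms in which each variable occurs at most once; $r$ may contain extra variables, that is, variables not occurring in $f(p_1,\dots,p_n)$. It is assumed that the rules of $P$ for the symbol $?$ are exactly $X\,?\,Y\to X$ and $X\,?\,Y\to Y$ (with $X\ne Y$). We write $P\vdash e\to^* e'$ for the reflexive-transitive closure of term rewriting, $C[l\sigma]\to C[r\sigma]$ for one-hole contexts $C$, rules $(l\to r)\in P$ and substitutions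 $\sigma$. Let $gen$ be a fresh function symbol of arity $0$. The program $gt(P)$ over $\Sigma\cup\{gen\}$ consists of the rules $gen\to c(gen,\dots,gen)$, one for each constructor symbol $c\in CS$, and of the rules $f(p_1,\dots,p_n)\to r[\overline{X}/gen]$, one for each rule $f(p_1,\dots,p_n)\to r$ of $P$, where $\overline X$ is the set of extra variables of that rule; here $[\overline X/gen]$ is the substitution that maps every variable of the finite set $\overline X$ to $gen$ and fixes all other variables. Let $\bot$ be a new constructor symbol of arity $0$. The shell of an expression is defined by $|X|=X$, $|c(e_1,\dots,e_n)|=c(|e_1|,\dots,|e_n|)$ for $c \in CS$, and $|f(e_1,\dots,e_n)|=\bot$ for function symbols $f$ (including $gen$). On expressions that may contain $\bot$, $\sqsubseteq$ is the least partial order such that $\bot\sqsubseteq e$ for all $e$, and $e\sqsubseteq e'$ implies $C[e]\sqsubseteq C[e']$ for all one-hole contexts $C$. Theorem (Lifting). Let $P$ be a program over $\Sigma$ and let $e$ be an expression over $\Sigma$. Soundness. Let $\overline X$ be a finite set of variables and $e'$ a ground expression over $\Sigma\cup\{gen\}$. If $gt(P)\vdash e[\overline X/gen]\to^* e'$, then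 there is a substitution $\sigma$ over $\Sigma$ with $\mathrm{dom}(\sigma)=\overline X$ such that $P\vdash e\sigma\to^* e''$ for some expression $e''$ over $\Sigma$ with $|e'|\sqsubseteq|e''|$; moreover, if $e'$ is a c-term $t$, then $P\vdash e\sigma\to^* t$ for this $\sigma$. Completeness. Let $\sigma$ be any substitution over $\Sigma$ (not necessarily normalized), and let $e'$ be a ground expression over $\Sigma$. If $P\vdash e\sigma\to^* e'$, then $gt(P)\vdash e[\overline X/gen]\to^* e''$ for $\overline X=\mathrm{dom}(\sigma)$ and some expression $e''$ over $\Sigma\cup\{gen\}$ with $|e'|\sqsubseteq|e''|$; moreover, if $e'$ is a c-term $t$, then $gt(P)\vdash e[\overline X/gen]\to^* t$. -/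

import Mathlib

universe u v w

namespace GenLift

noncomputable section

open scoped Classical

/-- A signature `Σ = CS ⊎ FS`: constructor symbols and defined function symbols, each family
indexed by arity, with a distinguished binary function symbol `?`. -/
structure Signature where
  Con : ℕ → Type u
  Fn : ℕ → Type v
  choice : Fn 2

/-- The constructor symbols of `Σ` together with the new constant constructor `⊥`. -/
inductive BotCon (Con : ℕ → Type u) : ℕ → Type u
  | bot : BotCon Con 0
  | old {n : ℕ} (c : Con n) : BotCon Con n

/-- The function symbols of `Σ` together with the fresh constant function symbol `gen`. -/
inductive GenFn (Fn : ℕ → Type v) : ℕ → Type v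
  | gen : GenFn Fn 0
  | old {n : ℕ} (f : Fn n) : GenFn Fn n

/-- The signature `Σ_⊥ = Σ ∪ {⊥}`. -/
abbrev Signature.withBot (S : Signature.{u, v}) : Signature.{u, v} where
  Con := BotCon S.Con
  Fn := S.Fn
  choice := S.choice

/-- The signature `Σ ∪ {gen}`. -/
abbrev Signature.withGen (S : Signature.{u, v}) : Signature.{u, v} where
  Con := S.Con
  Fn := GenFn S.Fn
  choice := GenFn.old S.choice

/-- Expressions `e ::= X | h(e₁, …, eₙ)` with `h` a constructor or a function symbol. -/
inductive Exp (S : Signature.{u, v}) (V : Type w) : Type (max u v w)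
  | var (x : V) : Exp S V
  | con {n : ℕ} (c : S.Con n) (args : Fin n → Exp S V) : Exp S V
  | fn {n : ℕ} (f : S.Fn n) (args : Fin n → Exp S V) : Exp S V

/-- Partial expressions are the expressions over `Σ_⊥`. -/
abbrev PExp (S : Signature.{u, v}) (V : Type w) := Exp S.withBot V

namespace Exp

variable {S : Signature.{u, v}} {V : Type w}

/-- The set of variables occurring in an expression. -/
def vars : Exp S V → Finset V
  | var x => {x}
  | con _ args => Finset.univ.biUnion fun i => (args i).vars
  | fn _ args => Finset.univ.biUnion fun i => (args i).vars

/-- The number of occurrences of the variable `x` in an expression. -/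
def occ (x : V) : Exp S V → ℕ
  | var y => if y = x then 1 else 0
  | con _ args => ∑ i, (args i).occ x
  | fn _ args => ∑ i, (args i).occ x

/-- An expression is ground if no variable occurs in it. -/
def IsGround (e : Exp S V) : Prop := e.vars = ∅

/-- The c-terms: expressions without function symbols. -/
def IsCTerm : Exp S V → Prop
  | var _ => True
  | con _ args => ∀ i, (args i).IsCTerm
  | fn _ _ => False

/-- The inclusion of the expressions over `Σ` in those over `Σ ∪ {gen}`. -/
def lift : Exp S V → Exp S.withGen V
  | var x => var x
  | con c args => con (S := S.withGen) c fun i => (args i).lift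
  | fn f args => fn (S := S.withGen) (GenFn.old f) fun i => (args i).lift

/-- The expression `gen`. -/
def gen : Exp S.withGen V := fn (S := S.withGen) GenFn.gen Fin.elim0

/-- The partial expression `⊥`. -/
def bot : PExp S V := con (S := S.withBot) BotCon.bot Fin.elim0

/-- The shell `|e|`. -/
def shell : Exp S V → PExp S V
  | var x => var x
  | con c args => con (S := S.withBot) (BotCon.old c) fun i => (args i).shell
  | fn _ _ => bot

end Exp

/-- One-hole contexts `C ::= [ ] | h(e₁, …, C, …, eₙ)`. In `con c i args C` and `fn f i args C` the
context `C` stands at argument position `i`, and the value of `args` at `i` is ignored. -/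
inductive Context (S : Signature.{u, v}) (V : Type w) : Type (max u v w)
  | hole : Context S V
  | con {n : ℕ} (c : S.Con n) (i : Fin n) (args : Fin n → Exp S V) (C : Context S V) : Context S V
  | fn {n : ℕ} (f : S.Fn n) (i : Fin n) (args : Fin n → Exp S V) (C : Context S V) : Context S V

/-- `C.plug e` is `C[e]`. -/
def Context.plug {S : Signature.{u, v}} {V : Type w} : Context S V → Exp S V → Exp S V
  | .hole, e => e
  | .con c i args C, e => .con c (Function.update args i (C.plug e))
  | .fn f i args C, e => .fn f (Function.update args i (C.plug e))

/-- The approximation ordering on partial expressions: the least preorder with `⊥ ⊑ e` that is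
closed under contexts. It is antisymmetric (`Approx.antisymm`), hence it is the least partial
ordering with these properties. -/
inductive Approx {S : Signature.{u, v}} {V : Type w} : PExp S V → PExp S V → Prop
  | refl (e : PExp S V) : Approx e e
  | trans {e₁ e₂ e₃ : PExp S V} : Approx e₁ e₂ → Approx e₂ e₃ → Approx e₁ e₃
  | bot_le (e : PExp S V) : Approx Exp.bot e
  | ctx (C : Context S.withBot V) {e e' : PExp S V} : Approx e e' → Approx (C.plug e) (C.plug e')

/-- Substitutions: mappings from variables to expressions that move only finitely many variables. -/
structure Subst (S : Signature.{u, v}) (V : Type w) where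
  toFun : V → Exp S V
  finite_dom : {x | toFun x ≠ Exp.var x}.Finite

/-- `dom(σ) = {X | Xσ ≠ X}`. -/
def Subst.dom {S : Signature.{u, v}} {V : Type w} (σ : Subst S V) : Finset V :=
  σ.finite_dom.toFinset

/-- `e.subst σ` is `eσ`. -/
def Exp.subst {S : Signature.{u, v}} {V : Type w} (σ : Subst S V) : Exp S V → Exp S V
  | .var x => σ.toFun x
  | .con c args => .con c fun i => (args i).subst σ
  | .fn f args => .fn f fun i => (args i).subst σ

/-- The substitution `[X̄/gen]`. -/
def genSubst {S : Signature.{u, v}} {V : Type w} (X : Finset V) : Subst S.withGen V where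
  toFun x := if x ∈ X then Exp.gen else Exp.var x
  finite_dom := X.finite_toSet.subset fun x hx => by
    by_contra h
    exact hx (if_neg h)

/-- A rewrite rule `f(p₁, …, pₙ) → r`. -/
structure Rule (S : Signature.{u, v}) (V : Type w) where
  arity : ℕ
  head : S.Fn arity
  pats : Fin arity → Exp S V
  rhs : Exp S V

namespace Rule

variable {S : Signature.{u, v}} {V : Type w}

/-- The left-hand side `f(p₁, …, pₙ)`. -/
def lhs (R : Rule S V) : Exp S V := .fn R.head R.pats

/-- The extra variables of a rule: those of the right-hand side that are not in the left-hand
side. -/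
def extraVars (R : Rule S V) : Finset V := R.rhs.vars \ R.lhs.vars

/-- `(p₁, …, pₙ)` is a tuple of c-terms in which every variable occurs at most once. -/
def IsCRule (R : Rule S V) : Prop :=
  (∀ i, (R.pats i).IsCTerm) ∧ ∀ x, ∑ i, (R.pats i).occ x ≤ 1

/-- The transformed rule `f(p₁, …, pₙ) → r[X̄/gen]`, with `X̄` the extra variables. -/
def gt (R : Rule S V) : Rule S.withGen V where
  arity := R.arity
  head := GenFn.old R.head
  pats i := (R.pats i).lift
  rhs := R.rhs.lift.subst (genSubst R.extraVars)

end Rule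

/-- The rule `gen → c(gen, …, gen)`. -/
def genRule {S : Signature.{u, v}} (V : Type w) {n : ℕ} (c : S.Con n) : Rule S.withGen V where
  arity := 0
  head := GenFn.gen
  pats := Fin.elim0
  rhs := .con (S := S.withGen) c fun _ => Exp.gen

/-- A set of rules is a left-linear constructor system (a program) if its rules are c-rewrite rules
and its rules for `?` are exactly `X ? Y → X` and `X ? Y → Y`, for two different variables. -/
def IsProgram {S : Signature.{u, v}} {V : Type w} (P : Set (Rule S V)) : Prop :=
  (∀ R ∈ P, R.IsCRule) ∧
  ∃ x y : V, x ≠ y ∧ ∀ (p : Fin 2 → Exp S V) (r : Exp S V),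
    (⟨2, S.choice, p, r⟩ : Rule S V) ∈ P ↔
      p = ![Exp.var x, Exp.var y] ∧ (r = Exp.var x ∨ r = Exp.var y)

/-- The transformation `gt(P)`: the rules for `gen` and the transformed rules of `P`. -/
def gt {S : Signature.{u, v}} {V : Type w} (P : Set (Rule S V)) : Set (Rule S.withGen V) :=
  {R | ∃ (n : ℕ) (c : S.Con n), R = genRule V c} ∪ Rule.gt '' P

/-- One rewriting step `C[lσ] → C[rσ]` with a rule `l → r` of `P`. -/
inductive Step {S : Signature.{u, v}} {V : Type w} (P : Set (Rule S V)) : Exp S V → Exp S V → Prop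
  | mk (C : Context S V) (R : Rule S V) (hR : R ∈ P) (σ : Subst S V) :
      Step P (C.plug (R.lhs.subst σ)) (C.plug (R.rhs.subst σ))

/-- `P ⊢ e →* e'`. -/
def Rewrites {S : Signature.{u, v}} {V : Type w} (P : Set (Rule S V)) : Exp S V → Exp S V → Prop :=
  Relation.ReflTransGen (Step P)

/-- The number of symbols different from `⊥`. -/
def psize {S : Signature.{u, v}} {V : Type w} : PExp S V → ℕ
  | .var _ => 1
  | .con BotCon.bot _ => 0
  | .con (BotCon.old _) args => 1 + ∑ i, psize (args i)
  | .fn _ args => 1 + ∑ i, psize (args i)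

theorem sum_psize_update_lt {S : Signature.{u, v}} {V : Type w} {n : ℕ} (args : Fin n → PExp S V)
    (i : Fin n) {a b : PExp S V} (h : psize a < psize b) :
    ∑ j, psize (Function.update args i a j) < ∑ j, psize (Function.update args i b j) := by
  refine Finset.sum_lt_sum (fun j _ => ?_) ⟨i, Finset.mem_univ i, by simpa using h⟩
  by_cases hj : j = i
  · subst hj; simpa using h.le
  · simp [Function.update_of_ne hj]

theorem psize_plug_lt {S : Signature.{u, v}} {V : Type w} (C : Context S.withBot V)
    {a b : PExp S V} (h : psize a < psize b) : psize (C.plug a) < psize (C.plug b) := by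
  induction C with
  | hole => exact h
  | con c i args C ih =>
    cases c with
    | bot => exact i.elim0
    | old c => simpa only [Context.plug, psize, add_lt_add_iff_left] using
        sum_psize_update_lt args i ih
  | fn f i args C ih =>
    simpa only [Context.plug, psize, add_lt_add_iff_left] using sum_psize_update_lt args i ih

theorem Approx.eq_or_psize_lt {S : Signature.{u, v}} {V : Type w} {a b : PExp S V}
    (h : Approx a b) : a = b ∨ psize a < psize b := by
  induction h with
  | refl e => exact Or.inl rfl
  | trans _ _ ih₁ ih₂ =>
    rcases ih₁ with rfl | h₁
    · exact ih₂
    · rcases ih₂ with rfl | h₂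
      · exact Or.inr h₁
      · exact Or.inr (h₁.trans h₂)
  | bot_le e =>
    cases e with
    | var x => exact Or.inr (by simp [psize, Exp.bot])
    | con c args =>
      cases c with
      | bot => exact Or.inl (congrArg _ (Subsingleton.elim _ _))
      | old c => exact Or.inr (by simp [psize, Exp.bot])
    | fn f args => exact Or.inr (by simp [psize, Exp.bot])
  | ctx C _ ih =>
    rcases ih with rfl | h
    · exact Or.inl rfl
    · exact Or.inr (psize_plug_lt C h)

theorem Approx.antisymm {S : Signature.{u, v}} {V : Type w} {a b : PExp S V}
    (h₁ : Approx a b) (h₂ : Approx b a) : a = b := by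
  rcases h₁.eq_or_psize_lt with h | h
  · exact h
  · rcases h₂.eq_or_psize_lt with h' | h'
    · exact h'.symm
    · exact absurd h h'.asymm

end

end GenLift

/-! Soundness. All occurrences of `gen` are filled by one expression over `Σ`, computed backwards
along the derivation. If `g` serves the rest of it, then before a step `gen → c(gen, …, gen)` the
value `c(g, …, g) ? g` serves: the rewritten occurrence chooses the left argument, every other
occurrence the right one (`Step.exists_fillGen`). The other rules keep `g`, which also instantiates
their extra variables. The value for the whole derivation defines `σ`, and filling never disturbs
the constructor part of `e'`.

Completeness. `GenLE b a` is a simulation: whatever `a` rewrites to in `P`, `b` can follow in `gt P`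
(`GenLE.rewrites`). A step inside a subexpression covered by `gen` needs no answer. Otherwise `gen`
is expanded as far as the patterns demand; linearity makes the matchers found for different
positions compatible. At the end the constructor part of the ground result is generated from the
remaining `gen`s (`GenLE.exists_shell`). -/

namespace GenLift

open scoped Classical

/-! ### Closure under contexts and argumentwise rewriting -/

section Contexts

variable {S : Signature.{u, v}} {V : Type w}

/-- A preorder that is closed under contexts is closed under constructor application. -/
theorem con_of_forall {r : Exp S V → Exp S V → Prop} (hrefl : ∀ a, r a a)
    (htrans : ∀ a b c, r a b → r b c → r a c)
    (hctx : ∀ (C : Context S V) (a b), r a b → r (C.plug a) (C.plug b))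
    {n : ℕ} (c : S.Con n) {a b : Fin n → Exp S V} (h : ∀ i, r (a i) (b i)) :
    r (.con c a) (.con c b) := by
  -- Arguments are changed one at a time; `s` holds the positions already changed.
  have key : ∀ s : Finset (Fin n), r (.con c a) (.con c (s.piecewise b a)) := by
    intro s
    induction s using Finset.induction_on with
    | empty => simpa using hrefl _
    | insert i s hi ih =>
      refine htrans _ _ _ ih ?_
      have := hctx (.con c i (s.piecewise b a) .hole) _ _ (h i)
      simp only [Context.plug] at this
      rw [Finset.piecewise_insert]
      convert this using 2
      rw [eq_comm, Function.update_eq_self_iff]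
      simp [hi]
  simpa using key Finset.univ

/-- A preorder that is closed under contexts is closed under function application. -/
theorem fn_of_forall {r : Exp S V → Exp S V → Prop} (hrefl : ∀ a, r a a)
    (htrans : ∀ a b c, r a b → r b c → r a c)
    (hctx : ∀ (C : Context S V) (a b), r a b → r (C.plug a) (C.plug b))
    {n : ℕ} (f : S.Fn n) {a b : Fin n → Exp S V} (h : ∀ i, r (a i) (b i)) :
    r (.fn f a) (.fn f b) := by
  have key : ∀ s : Finset (Fin n), r (.fn f a) (.fn f (s.piecewise b a)) := by
    intro s
    induction s using Finset.induction_on with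
    | empty => simpa using hrefl _
    | insert i s hi ih =>
      refine htrans _ _ _ ih ?_
      have := hctx (.fn f i (s.piecewise b a) .hole) _ _ (h i)
      simp only [Context.plug] at this
      rw [Finset.piecewise_insert]
      convert this using 2
      rw [eq_comm, Function.update_eq_self_iff]
      simp [hi]
  simpa using key Finset.univ

theorem Approx.con {n : ℕ} (c : S.withBot.Con n) {a b : Fin n → PExp S V}
    (h : ∀ i, Approx (a i) (b i)) : Approx (Exp.con (S := S.withBot) c a) (.con c b) :=
  con_of_forall Approx.refl (fun _ _ _ => Approx.trans) (fun C _ _ => Approx.ctx C) c h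

/-- Composition of contexts. -/
def Context.comp : Context S V → Context S V → Context S V
  | .hole, D => D
  | .con c i args C, D => .con c i args (C.comp D)
  | .fn f i args C, D => .fn f i args (C.comp D)

theorem Context.plug_comp (C D : Context S V) (e : Exp S V) :
    (C.comp D).plug e = C.plug (D.plug e) := by
  induction C with
  | hole => rfl
  | con c i args C ih => simp [Context.comp, Context.plug, ih]
  | fn f i args C ih => simp [Context.comp, Context.plug, ih]

variable {P : Set (Rule S V)}

theorem Step.plug (C : Context S V) {a b : Exp S V} (h : Step P a b) :
    Step P (C.plug a) (C.plug b) := by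
  cases h with
  | mk D R hR σ =>
    rw [← Context.plug_comp, ← Context.plug_comp]
    exact .mk _ R hR σ

theorem Rewrites.plug (C : Context S V) {a b : Exp S V} (h : Rewrites P a b) :
    Rewrites P (C.plug a) (C.plug b) :=
  by
  induction h with
  | refl => exact .refl
  | tail _ h ih => exact .tail ih (h.plug C)

theorem Rewrites.con {n : ℕ} (c : S.Con n) {a b : Fin n → Exp S V}
    (h : ∀ i, Rewrites P (a i) (b i)) : Rewrites P (.con c a) (.con c b) :=
  con_of_forall (fun _ => .refl) (fun _ _ _ => .trans) (fun C _ _ => Rewrites.plug C) c h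

theorem Rewrites.fn {n : ℕ} (f : S.Fn n) {a b : Fin n → Exp S V}
    (h : ∀ i, Rewrites P (a i) (b i)) : Rewrites P (.fn f a) (.fn f b) :=
  fn_of_forall (fun _ => .refl) (fun _ _ _ => .trans) (fun C _ _ => Rewrites.plug C) f h

end Contexts

/-! ### Instantiation by arbitrary maps, and the rules as rewrites -/

section Bind

variable {S : Signature.{u, v}} {V : Type w}

/-- Simultaneous replacement of all variables, without a finiteness condition. -/
def Exp.bind (θ : V → Exp S V) : Exp S V → Exp S V
  | .var x => θ x
  | .con c args => .con c fun i => (args i).bind θ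
  | .fn f args => .fn f fun i => (args i).bind θ

theorem Exp.subst_eq_bind (σ : Subst S V) (e : Exp S V) : e.subst σ = e.bind σ.toFun := by
  induction e with
  | var x => rfl
  | con c args ih => simp [Exp.subst, Exp.bind, ih]
  | fn f args ih => simp [Exp.subst, Exp.bind, ih]

theorem Exp.bind_congr {θ η : V → Exp S V} {e : Exp S V} (h : ∀ x ∈ e.vars, θ x = η x) :
    e.bind θ = e.bind η := by
  induction e with
  | var x => exact h x (by simp [Exp.vars])
  | con c args ih =>
    simp only [Exp.bind, Exp.con.injEq, heq_eq_eq, true_and]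
    exact funext fun i => ih i fun x hx => h x (by simpa [Exp.vars] using ⟨i, hx⟩)
  | fn f args ih =>
    simp only [Exp.bind, Exp.fn.injEq, heq_eq_eq, true_and]
    exact funext fun i => ih i fun x hx => h x (by simpa [Exp.vars] using ⟨i, hx⟩)

theorem Exp.bind_bind (θ η : V → Exp S V) (e : Exp S V) :
    (e.bind θ).bind η = e.bind fun x => (θ x).bind η := by
  induction e with
  | var x => rfl
  | con c args ih => simp [Exp.bind, ih]
  | fn f args ih => simp [Exp.bind, ih]

theorem Exp.vars_lift (e : Exp S V) : e.lift.vars = e.vars := by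
  induction e with
  | var x => rfl
  | con c args ih => simp [Exp.lift, Exp.vars, ih]
  | fn f args ih => simp [Exp.lift, Exp.vars, ih]

theorem Exp.occ_pos_of_mem_vars {x : V} {e : Exp S V} (h : x ∈ e.vars) : 0 < e.occ x := by
  induction e with
  | var y =>
    simp only [Exp.vars, Finset.mem_singleton] at h
    simp [Exp.occ, h]
  | con c args ih =>
    simp only [Exp.vars, Finset.mem_biUnion, Finset.mem_univ, true_and] at h
    obtain ⟨i, hi⟩ := h
    exact Finset.sum_pos' (fun _ _ => Nat.zero_le _) ⟨i, Finset.mem_univ i, ih i hi⟩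
  | fn f args ih =>
    simp only [Exp.vars, Finset.mem_biUnion, Finset.mem_univ, true_and] at h
    obtain ⟨i, hi⟩ := h
    exact Finset.sum_pos' (fun _ _ => Nat.zero_le _) ⟨i, Finset.mem_univ i, ih i hi⟩

/-- The substitution that agrees with `θ` on `X` and fixes all other variables. -/
noncomputable def Subst.ofFinset (X : Finset V) (θ : V → Exp S V) : Subst S V where
  toFun x := if x ∈ X then θ x else .var x
  finite_dom := X.finite_toSet.subset fun x hx => by
    by_contra h
    exact hx (if_neg h)

theorem Subst.ofFinset_of_mem {X : Finset V} (θ : V → Exp S V) {x : V} (hx : x ∈ X) :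
    (Subst.ofFinset X θ).toFun x = θ x :=
  if_pos hx

/-- Only the finitely many variables of the rule matter, so `θ` may be cut down to a genuine
substitution. Matchers need no finiteness condition from here on. -/
theorem Rewrites.rule {P : Set (Rule S V)} {R : Rule S V} (hR : R ∈ P) (θ : V → Exp S V) :
    Rewrites P (R.lhs.bind θ) (R.rhs.bind θ) := by
  have h := Step.mk .hole R hR (Subst.ofFinset (R.lhs.vars ∪ R.rhs.vars) θ)
  simp only [Context.plug, Exp.subst_eq_bind] at h
  rw [Exp.bind_congr (e := R.lhs) fun x hx => Subst.ofFinset_of_mem θ (Finset.mem_union_left _ hx),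
    Exp.bind_congr (e := R.rhs) fun x hx => Subst.ofFinset_of_mem θ (Finset.mem_union_right _ hx)] at h
  exact .single h

theorem IsProgram.choice_left {P : Set (Rule S V)} (hP : IsProgram P) (a b : Exp S V) :
    Rewrites P (.fn S.choice ![a, b]) a := by
  obtain ⟨-, x, y, hxy, h⟩ := hP
  have := Rewrites.rule ((h ![.var x, .var y] (.var x)).2 ⟨rfl, .inl rfl⟩)
    fun z => if z = x then a else b
  convert this using 1
  · simp only [Rule.lhs, Exp.bind, Exp.fn.injEq, heq_eq_eq, true_and]
    funext i
    fin_cases i <;> simp [Exp.bind, hxy.symm]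
  · simp [Exp.bind]

theorem IsProgram.choice_right {P : Set (Rule S V)} (hP : IsProgram P) (a b : Exp S V) :
    Rewrites P (.fn S.choice ![a, b]) b := by
  obtain ⟨-, x, y, hxy, h⟩ := hP
  have := Rewrites.rule ((h ![.var x, .var y] (.var y)).2 ⟨rfl, .inr rfl⟩)
    fun z => if z = x then a else b
  convert this using 1
  · simp only [Rule.lhs, Exp.bind, Exp.fn.injEq, heq_eq_eq, true_and]
    funext i
    fin_cases i <;> simp [Exp.bind, hxy.symm]
  · simp [Exp.bind, hxy.symm]

theorem Rule.gt_rhs_bind (R : Rule S V) (θ : V → Exp S.withGen V) :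
    R.gt.rhs.bind θ =
      R.rhs.lift.bind fun x => if x ∈ R.extraVars then Exp.gen else θ x := by
  simp only [Rule.gt, Exp.subst_eq_bind, Exp.bind_bind]
  congr 1
  funext x
  by_cases h : x ∈ R.extraVars
  · simp only [genSubst, h, if_true, Exp.gen, Exp.bind]
    congr 1
    exact Subsingleton.elim _ _
  · simp only [genSubst, h, if_false, Exp.bind]

theorem Rule.gt_lhs (R : Rule S V) : R.gt.lhs = R.lhs.lift := rfl

theorem Rewrites.gen {P : Set (Rule S V)} {n : ℕ} (c : S.Con n) :
    Rewrites (gt P) Exp.gen (.con (S := S.withGen) c fun _ => Exp.gen) := by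
  have h := Rewrites.rule (P := gt P) (.inl ⟨n, c, rfl⟩) (Exp.var (S := S.withGen))
  convert h using 1
  · simp only [Rule.lhs, genRule, Exp.gen, Exp.bind]
    congr 1
    exact Subsingleton.elim _ _
  · simp only [genRule, Exp.gen, Exp.bind]
    congr 1
    funext i
    congr 1
    exact Subsingleton.elim _ _

end Bind

/-! ### Soundness: filling `gen` with nested choices -/

section Soundness

variable {S : Signature.{u, v}} {V : Type w}

/-- Replacement of every occurrence of `gen` by `g`. -/
def Exp.fillGen : Exp S.withGen V → Exp S V → Exp S V
  | .var x, _ => .var x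
  | .con c args, g => .con (S := S) c fun i => (args i).fillGen g
  | .fn GenFn.gen _, g => g
  | .fn (GenFn.old f) args, g => .fn f fun i => (args i).fillGen g

theorem Exp.fillGen_gen (g : Exp S V) : Exp.gen.fillGen g = g := rfl

theorem Exp.fillGen_bind_lift (g : Exp S V) (θ : V → Exp S.withGen V) (e : Exp S V) :
    (e.lift.bind θ).fillGen g = e.bind fun x => (θ x).fillGen g := by
  induction e with
  | var x => rfl
  | con c args ih => simp [Exp.lift, Exp.bind, Exp.fillGen, ih]
  | fn f args ih => simp [Exp.lift, Exp.bind, Exp.fillGen, ih]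

theorem Exp.fillGen_rewrites {P : Set (Rule S V)} {g g' : Exp S V} (h : Rewrites P g g')
    (e : Exp S.withGen V) : Rewrites P (e.fillGen g) (e.fillGen g') := by
  induction e with
  | var x => exact .refl
  | con c args ih => exact Rewrites.con _ ih
  | fn f args ih =>
    cases f with
    | gen => exact h
    | old f =>
      simp only [Exp.fillGen]
      exact Rewrites.fn f ih

/-- If the redex can be simulated, so can the step in a context. -/
theorem Exp.fillGen_plug_rewrites {P : Set (Rule S V)} {g g' : Exp S V} (h : Rewrites P g g')
    (C : Context S.withGen V) {a b : Exp S.withGen V}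
    (hab : Rewrites P (a.fillGen g) (b.fillGen g')) :
    Rewrites P ((C.plug a).fillGen g) ((C.plug b).fillGen g') := by
  induction C with
  | hole => exact hab
  | con c i args C ih =>
    refine Rewrites.con _ fun j => ?_
    by_cases hj : j = i
    · subst hj
      simpa using ih
    · simpa [Function.update_of_ne hj] using Exp.fillGen_rewrites h _
  | fn f i args C ih =>
    cases f with
    | gen => exact i.elim0
    | old f =>
      simp only [Context.plug, Exp.fillGen]
      refine Rewrites.fn f fun j => ?_
      by_cases hj : j = i
      · subst hj
        simpa using ih
      · simpa [Function.update_of_ne hj] using Exp.fillGen_rewrites h _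

/-- A step of `gt P` is simulated in `P`, at the price of a more general value for `gen`. -/
theorem Step.exists_fillGen {P : Set (Rule S V)} (hP : IsProgram P) {a b : Exp S.withGen V}
    (h : Step (GenLift.gt P) a b) {g : Exp S V} (hg : ∀ x, g ≠ .var x) :
    ∃ g' : Exp S V, (∀ x, g' ≠ .var x) ∧ Rewrites P (a.fillGen g') (b.fillGen g) := by
  obtain ⟨C, R, hR, σ⟩ := h
  rcases hR with ⟨n, c, rfl⟩ | ⟨R, hR, rfl⟩
  -- The right alternative restores `g` at all occurrences of `gen` outside the redex.
  · refine ⟨.fn S.choice ![.con c fun _ => g, g], by simp, ?_⟩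
    exact Exp.fillGen_plug_rewrites (hP.choice_right _ _) C (hP.choice_left _ _)
  · refine ⟨g, hg, Exp.fillGen_plug_rewrites .refl C ?_⟩
    rw [Exp.subst_eq_bind, Exp.subst_eq_bind, Rule.gt_rhs_bind, Rule.gt_lhs,
      Exp.fillGen_bind_lift, Exp.fillGen_bind_lift]
    convert Rewrites.rule hR
      (fun x => Exp.fillGen (if x ∈ R.extraVars then Exp.gen else σ.toFun x) g) using 1
    -- Sending extra variables to `gen`, hence to `g`, does not affect the left-hand side.
    refine Exp.bind_congr fun x hx => ?_
    have hx' : x ∉ R.extraVars := fun h => (Finset.mem_sdiff.1 h).2 hx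
    rw [if_neg hx']

/-- The induction adds steps at the front, since the earlier value of `gen` is built from the later
one. That `g` is no variable will make the domain of the substitution exactly `X`. -/
theorem Rewrites.exists_fillGen {P : Set (Rule S V)} (hP : IsProgram P) {a b : Exp S.withGen V}
    (h : Rewrites (GenLift.gt P) a b) :
    ∃ g g' : Exp S V, (∀ x, g ≠ .var x) ∧ Rewrites P (a.fillGen g) (b.fillGen g') := by
  induction h using Relation.ReflTransGen.head_induction_on with
  | refl =>
    obtain ⟨-, x, y, -⟩ := hP
    -- At the end of the derivation any expression other than a variable would do.
    exact ⟨.fn S.choice fun _ => .var x, _, by simp, .refl⟩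
  | head h _ ih =>
    obtain ⟨g, g', hg, hr⟩ := ih
    obtain ⟨g₁, hg₁, hr₁⟩ := h.exists_fillGen hP hg
    exact ⟨g₁, g', hg₁, hr₁.trans hr⟩

theorem Exp.shell_approx_fillGen (g : Exp S V) (e : Exp S.withGen V) :
    Approx e.shell (e.fillGen g).lift.shell := by
  induction e with
  | var x => exact .refl _
  | con c args ih => exact Approx.con _ ih
  | fn f args ih => exact .bot_le _

theorem Exp.IsCTerm.lift_fillGen (g : Exp S V) {e : Exp S.withGen V} (h : e.IsCTerm) :
    (e.fillGen g).lift = e := by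
  induction e with
  | var x => rfl
  | con c args ih => simp [Exp.lift, Exp.fillGen, fun i => ih i (h i)]
  | fn f args ih => exact h.elim

end Soundness

/-! ### Completeness: simulation below `gen` -/

section Completeness

variable {S : Signature.{u, v}} {V : Type w}

/-- `GenLE b a`: `b` arises from `a` by replacing some subexpressions by `gen`. -/
inductive GenLE : Exp S.withGen V → Exp S V → Prop
  | gen (a : Exp S V) : GenLE Exp.gen a
  | var (x : V) : GenLE (.var x) (.var x)
  | con {n : ℕ} (c : S.Con n) {bs : Fin n → Exp S.withGen V} {as : Fin n → Exp S V}
      (h : ∀ i, GenLE (bs i) (as i)) : GenLE (.con (S := S.withGen) c bs) (.con c as)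
  | fn {n : ℕ} (f : S.Fn n) {bs : Fin n → Exp S.withGen V} {as : Fin n → Exp S V}
      (h : ∀ i, GenLE (bs i) (as i)) : GenLE (.fn (S := S.withGen) (GenFn.old f) bs) (.fn f as)

theorem GenLE.bind_lift {θ' : V → Exp S.withGen V} {θ : V → Exp S V} (e : Exp S V)
    (h : ∀ x, GenLE (θ' x) (θ x)) : GenLE (e.lift.bind θ') (e.bind θ) := by
  induction e with
  | var x => exact h x
  | con c args ih => exact .con _ ih
  | fn f args ih => exact .fn _ ih

/-- Below an expression with a constructor at the root, one can rewrite to such an expression. -/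
theorem GenLE.exists_con (P : Set (Rule S V)) {n : ℕ} {c : S.Con n} {as : Fin n → Exp S V}
    {b : Exp S.withGen V} (h : GenLE b (.con c as)) :
    ∃ bs : Fin n → Exp S.withGen V, (∀ i, GenLE (bs i) (as i)) ∧
      Rewrites (GenLift.gt P) b (.con (S := S.withGen) c bs) := by
  cases h with
  | gen => exact ⟨_, fun i => .gen _, Rewrites.gen c⟩
  | con _ h => exact ⟨_, h, .refl⟩

/-- Matchers of the components of a linear tuple can be merged. -/
theorem exists_merge {P : Set (Rule S V)} {n : ℕ} {ps : Fin n → Exp S V}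
    (hlin : ∀ x, ∑ i, (ps i).occ x ≤ 1) {θ : V → Exp S V} {bs : Fin n → Exp S.withGen V}
    (h : ∀ i, ∃ θ' : V → Exp S.withGen V, (∀ x, GenLE (θ' x) (θ x)) ∧
      Rewrites (gt P) (bs i) ((ps i).lift.bind θ')) :
    ∃ θ' : V → Exp S.withGen V, (∀ x, GenLE (θ' x) (θ x)) ∧
      ∀ i, Rewrites (gt P) (bs i) ((ps i).lift.bind θ') := by
  choose η hη hr using h
  -- By linearity each variable belongs to at most one component, whose matcher decides its value.
  have huniq : ∀ x i j, x ∈ (ps i).vars → x ∈ (ps j).vars → i = j := by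
    intro x i j hi hj
    by_contra hij
    have h₁ := Finset.add_le_sum (f := fun k => (ps k).occ x) (fun _ _ => Nat.zero_le _)
      (Finset.mem_univ i) (Finset.mem_univ j) hij
    have h₂ := Exp.occ_pos_of_mem_vars hi
    have h₃ := Exp.occ_pos_of_mem_vars hj
    have h₄ := hlin x
    omega
  -- Variables in no pattern get `gen`, which lies below every value.
  refine ⟨fun x => if h : ∃ i, x ∈ (ps i).vars then η h.choose x else Exp.gen, fun x => ?_,
    fun i => ?_⟩
  · dsimp only
    split
    · exact hη _ x
    · exact .gen _
  · rw [Exp.bind_congr (η := η i) fun x hx => ?_]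
    · exact hr i
    · rw [Exp.vars_lift] at hx
      have hex : ∃ i, x ∈ (ps i).vars := ⟨i, hx⟩
      rw [dif_pos hex, huniq x _ i hex.choose_spec hx]

/-- An expression below an instance of a linear c-term rewrites to an instance of it. -/
theorem GenLE.exists_matcher (P : Set (Rule S V)) {p : Exp S V} (hp : p.IsCTerm)
    (hlin : ∀ x, p.occ x ≤ 1) {θ : V → Exp S V} {b : Exp S.withGen V} (h : GenLE b (p.bind θ)) :
    ∃ θ' : V → Exp S.withGen V, (∀ x, GenLE (θ' x) (θ x)) ∧
      Rewrites (GenLift.gt P) b (p.lift.bind θ') := by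
  induction p generalizing b with
  | var x =>
    refine ⟨fun y => if y = x then b else Exp.gen, fun y => ?_, ?_⟩
    · by_cases hy : y = x
      · subst hy
        simpa [Exp.bind] using h
      · simpa [hy] using GenLE.gen _
    · simp [Exp.lift, Exp.bind, Rewrites, Relation.ReflTransGen.refl]
  | con c ps ih =>
    obtain ⟨bs, hbs, hr⟩ := GenLE.exists_con P h
    have hlin' : ∀ x, ∑ i, (ps i).occ x ≤ 1 := hlin
    obtain ⟨θ', hθ', hr'⟩ := exists_merge hlin' fun i => ih i (hp i)
      (fun x => (Finset.single_le_sum (f := fun k => (ps k).occ x) (fun _ _ => Nat.zero_le _)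
        (Finset.mem_univ i)).trans (hlin' x)) (hbs i)
    exact ⟨θ', hθ', hr.trans (Rewrites.con (S := S.withGen) c hr')⟩
  | fn f ps ih => exact hp.elim

/-- If `gen` covers the redex, it covers the contractum too. Otherwise the arguments are rewritten
until the transformed rule applies; the `gen`s it puts for extra variables lie below whatever `θ`
chose. -/
theorem GenLE.rewrites_redex {P : Set (Rule S V)} (hP : IsProgram P) {R : Rule S V} (hR : R ∈ P)
    {θ : V → Exp S V} {b : Exp S.withGen V} (h : GenLE b (R.lhs.bind θ)) :
    ∃ b' : Exp S.withGen V, Rewrites (GenLift.gt P) b b' ∧ GenLE b' (R.rhs.bind θ) := by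
  obtain ⟨hc, hlin⟩ := hP.1 R hR
  rw [Rule.lhs, Exp.bind] at h
  cases h with
  | gen => exact ⟨_, .refl, .gen _⟩
  | fn _ h =>
    obtain ⟨θ', hθ', hr⟩ := exists_merge (P := P) hlin fun i =>
      GenLE.exists_matcher P (hc i)
        (fun x => (Finset.single_le_sum (f := fun k => (R.pats k).occ x)
          (fun _ _ => Nat.zero_le _) (Finset.mem_univ i)).trans (hlin x)) (h i)
    refine ⟨_, (Rewrites.fn (S := S.withGen) (GenFn.old R.head) hr).trans
      (Rewrites.rule (R := R.gt) (.inr ⟨R, hR, rfl⟩) θ'), ?_⟩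
    rw [Rule.gt_rhs_bind]
    refine GenLE.bind_lift _ fun x => ?_
    split
    · exact .gen _
    · exact hθ' x

theorem GenLE.rewrites_plug {P : Set (Rule S V)} {a a' : Exp S V}
    (ha : ∀ b : Exp S.withGen V, GenLE b a →
      ∃ b' : Exp S.withGen V, Rewrites (GenLift.gt P) b b' ∧ GenLE b' a')
    (C : Context S V) {b : Exp S.withGen V} (h : GenLE b (C.plug a)) :
    ∃ b' : Exp S.withGen V, Rewrites (GenLift.gt P) b b' ∧ GenLE b' (C.plug a') := by
  induction C generalizing b with
  | hole => exact ha b h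
  | con c i args C ih =>
    rw [Context.plug] at h
    cases h with
    | gen => exact ⟨_, .refl, .gen _⟩
    | @con _ _ bs _ h =>
      obtain ⟨b', hr, hb'⟩ := ih (b := bs i) (by simpa using h i)
      refine ⟨.con (S := S.withGen) c (Function.update bs i b'),
        Rewrites.con _ fun j => ?_, .con _ fun j => ?_⟩
      all_goals
        by_cases hj : j = i
        · subst hj
          simpa
        · have := h j
          simp_all [Rewrites, Relation.ReflTransGen.refl]
  | fn f i args C ih =>
    rw [Context.plug] at h
    cases h with
    | gen => exact ⟨_, .refl, .gen _⟩
    | @fn _ _ bs _ h =>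
      obtain ⟨b', hr, hb'⟩ := ih (b := bs i) (by simpa using h i)
      refine ⟨.fn (S := S.withGen) (GenFn.old f) (Function.update bs i b'),
        Rewrites.fn _ fun j => ?_, .fn _ fun j => ?_⟩
      all_goals
        by_cases hj : j = i
        · subst hj
          simpa
        · have := h j
          simp_all [Rewrites, Relation.ReflTransGen.refl]

theorem GenLE.rewrites {P : Set (Rule S V)} (hP : IsProgram P) {a a' : Exp S V}
    (ha : Rewrites P a a') {b : Exp S.withGen V} (h : GenLE b a) :
    ∃ b' : Exp S.withGen V, Rewrites (GenLift.gt P) b b' ∧ GenLE b' a' := by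
  induction ha with
  | refl => exact ⟨b, .refl, h⟩
  | tail _ hs ih =>
    obtain ⟨b₁, hr₁, hb₁⟩ := ih
    obtain ⟨C, R, hR, σ⟩ := hs
    obtain ⟨b₂, hr₂, hb₂⟩ := GenLE.rewrites_plug (P := P) (a' := R.rhs.subst σ) (fun b hb => by
      rw [Exp.subst_eq_bind] at hb ⊢
      exact GenLE.rewrites_redex hP hR hb) C hb₁
    exact ⟨b₂, hr₁.trans hr₂, hb₂⟩

theorem Exp.IsGround.arg_con {n : ℕ} {c : S.Con n} {as : Fin n → Exp S V}
    (h : (Exp.con c as).IsGround) (i : Fin n) : (as i).IsGround :=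
  Finset.subset_empty.1 (h ▸ Finset.subset_biUnion_of_mem (fun i => (as i).vars)
    (Finset.mem_univ i))

/-- The constructor part of a ground expression can be generated. -/
theorem GenLE.exists_shell (P : Set (Rule S V)) {a : Exp S V} (ha : a.IsGround)
    {b : Exp S.withGen V} (h : GenLE b a) :
    ∃ b' : Exp S.withGen V, Rewrites (GenLift.gt P) b b' ∧ Approx a.lift.shell b'.shell ∧
      (a.IsCTerm → b' = a.lift) := by
  induction a generalizing b with
  -- Groundness excludes variables, for which `gen` has no rule.
  | var x => simp [Exp.IsGround, Exp.vars] at ha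
  | con c as ih =>
    obtain ⟨bs, hbs, hr⟩ := GenLE.exists_con P h
    choose b' hr' hb' ht using fun i => ih i (ha.arg_con i) (hbs i)
    refine ⟨.con (S := S.withGen) c b', hr.trans (Rewrites.con (S := S.withGen) c hr'),
      Approx.con _ hb', fun hc => ?_⟩
    rw [Exp.lift, funext fun i => ht i (hc i)]
  | fn f as ih => exact ⟨b, .refl, .bot_le _, False.elim⟩

end Completeness

end GenLift

theorem mainTheorem1 {S : GenLift.Signature.{u, v}} {V : Type w} [Countable V] [Infinite V]
    (P : Set (GenLift.Rule S V)) (hP : GenLift.IsProgram P) :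
    -- Soundness
    (∀ (e : GenLift.Exp S V) (X : Finset V) (e' : GenLift.Exp S.withGen V), e'.IsGround →
      GenLift.Rewrites (GenLift.gt P) (e.lift.subst (GenLift.genSubst X)) e' →
      ∃ σ : GenLift.Subst S V, σ.dom = X ∧
        (∃ e'' : GenLift.Exp S V, GenLift.Rewrites P (e.subst σ) e'' ∧
          GenLift.Approx e'.shell e''.lift.shell) ∧
        (e'.IsCTerm → ∃ t : GenLift.Exp S V, t.lift = e' ∧ GenLift.Rewrites P (e.subst σ) t)) ∧
    -- Completeness
    (∀ (e e' : GenLift.Exp S V) (σ : GenLift.Subst S V), e'.IsGround →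
      GenLift.Rewrites P (e.subst σ) e' →
      (∃ e'' : GenLift.Exp S.withGen V,
        GenLift.Rewrites (GenLift.gt P) (e.lift.subst (GenLift.genSubst σ.dom)) e'' ∧
          GenLift.Approx e'.lift.shell e''.shell) ∧
      (e'.IsCTerm →
        GenLift.Rewrites (GenLift.gt P) (e.lift.subst (GenLift.genSubst σ.dom)) e'.lift)) := by
  refine ⟨fun e X e' _ h => ?_, fun e e' σ hg h => ?_⟩
  · obtain ⟨g, g', hg, hr⟩ := GenLift.Rewrites.exists_fillGen hP h
    have he : (e.lift.subst (GenLift.genSubst X)).fillGen g =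
        e.subst (GenLift.Subst.ofFinset X fun _ => g) := by
      rw [GenLift.Exp.subst_eq_bind, GenLift.Exp.subst_eq_bind, GenLift.Exp.fillGen_bind_lift]
      congr 1
      funext x
      by_cases hx : x ∈ X
      · simp [GenLift.genSubst, GenLift.Subst.ofFinset, hx, GenLift.Exp.fillGen_gen]
      · simp [GenLift.genSubst, GenLift.Subst.ofFinset, hx, GenLift.Exp.fillGen]
    rw [he] at hr
    refine ⟨_, ?_, ⟨_, hr, GenLift.Exp.shell_approx_fillGen g' e'⟩,
      fun hc => ⟨_, hc.lift_fillGen g', hr⟩⟩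
    ext x
    -- On `X` the value `g` differs from `x` because it is not a variable.
    by_cases hx : x ∈ X <;> simp [GenLift.Subst.dom, GenLift.Subst.ofFinset, hx, hg x]
  · have h₀ : GenLift.GenLE (e.lift.subst (GenLift.genSubst σ.dom)) (e.subst σ) := by
      rw [GenLift.Exp.subst_eq_bind, GenLift.Exp.subst_eq_bind]
      refine GenLift.GenLE.bind_lift e fun x => ?_
      by_cases hx : x ∈ σ.dom
      · simpa [GenLift.genSubst, hx] using GenLift.GenLE.gen _
      · have hx' : σ.toFun x = .var x := by simpa [GenLift.Subst.dom] using hx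
        simpa [GenLift.genSubst, hx, hx'] using GenLift.GenLE.var x
    obtain ⟨b, hr, hb⟩ := h₀.rewrites hP h
    obtain ⟨b', hr', hs, ht⟩ := hb.exists_shell P hg
    exact ⟨⟨b', hr.trans hr', hs⟩, fun hc => ht hc ▸ hr.trans hr'⟩
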